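/- Let $p,q\in(2,\infty)$ or $p,q\in(1,2)$. Let $\ell_p(\ell_q)$ be the real Banach space of all sequences $x=(x(k))_{k\ge 1}$ in the real space $\ell_q=\ell_q(\mathbb{N})$ with norm $\|x\|=\big(\sum_{k=1}^\infty\|x(k)\|_q^p\big)^{1/p}<\infty$. Then the range $Y$ of every contractive projection $P$ on $\ell_p(\ell_q)$ (a bounded linear operator $P$ with $P^2=P$ and $\|P\|\le 1$) has a block basis, that is, $Y$ has a basis $\{y_i\}_{i=1}^{\dim Y}$ (a finite linear basis, possibly empty, if $\dim Y<\infty$, and a Schauder basis if $\dim Y=\infty$) such that for all $i\ne j$ the vectors $y_i$ and $y_j$ are disjoint: there is no pair $(k,l)\in\mathbb{N}\times\mathbb{N}$ for which the $l$-th coordinates of both $y_i(k)$ and $y_j(k)$ are nonzero. -/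

import Mathlib

open scoped ENNReal

/-- The real vector-valued sequence space `ℓ_p(ℓ_q)`: sequences `x : ℕ → ℓ_q` with
`∑ k, ‖x k‖_q ^ p < ∞`, normed by `(∑ k, ‖x k‖_q ^ p) ^ (1 / p)`. -/
noncomputable abbrev LpLq (p q : ℝ≥0∞) [Fact (1 ≤ q)] : AddSubgroup (PreLp fun _ : ℕ => lp (fun _ : ℕ => ℝ) q) :=
  lp (fun _ : ℕ => lp (fun _ : ℕ => ℝ) q) p

/-- The support of `x` with respect to the standard unit vector basis `(e_{kj})` of `ℓ_p(ℓ_q)`. -/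
def LpLq.supp {p q : ℝ≥0∞} [Fact (1 ≤ q)] (x : LpLq p q) : Set (ℕ × ℕ) :=
  {i | x i.1 i.2 ≠ 0}

/-- A subspace `Y` of `ℓ_p(ℓ_q)` has a block basis: a basis `(y_i)`, `1 ≤ i ≤ dim Y`, of pairwise
disjointly supported vectors. If `dim Y` is finite this is an algebraic basis indexed by `Fin n`
(with `n = dim Y`); otherwise it is a Schauder basis of `Y`. -/
def LpLq.HasBlockBasis {p q : ℝ≥0∞} [Fact (1 ≤ p)] [Fact (1 ≤ q)]
    (Y : Submodule ℝ (LpLq p q)) : Prop :=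
  (∃ (n : ℕ) (b : Module.Basis (Fin n) ℝ Y),
      ∀ i j, i ≠ j → Disjoint (supp (b i : LpLq p q)) (supp (b j : LpLq p q))) ∨
  (∃ b : SchauderBasis ℝ Y,
      ∀ i j, i ≠ j → Disjoint (supp (b i : LpLq p q)) (supp (b j : LpLq p q)))

/-- A contractive projection: an idempotent bounded linear operator of norm at most one. -/
structure IsContractiveProjection {X : Type*} [NormedAddCommGroup X] [NormedSpace ℝ X]
    (P : X →L[ℝ] X) : Prop where
  idempotent : ∀ x, P (P x) = P x
  norm_le : ‖P‖ ≤ 1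

/-!
A contractive projection `P` with range `Y` interacts well with the bands of `ℓ_p(ℓ_q)`, the
subspaces of all vectors supported in a given set of indices, because of how the norm grows near a
fixed point `x` of `P`: since `P` is a contraction, `‖x + t P w‖ ≤ ‖x + t w‖` for all `w` and `t`.

If `p, q > 2` and `w` is disjoint from `x`, the `p`-th power of the right-hand side is at most
`‖x‖ ^ p + o(t ^ 2)`. If `P w` were not disjoint from `x`, then `2`-convexity would make the
symmetrization in `t` of the `p`-th power of the left-hand side at least `‖x‖ ^ p + κ t ^ 2`. So `P`
maps vectors disjoint from `x` to vectors disjoint from `x`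
(`LpLq.coord_apply_unitVec_of_two_lt`). If `p, q < 2` and `w` lies in the band of `x`, the
symmetrized right-hand side is `‖x‖ ^ p + O(t ^ 2)`, whereas a component of `P w` outside of the
band of `x` would contribute at least `κ t ^ max p q` on the left. So `P` leaves the band of `x`
invariant (`LpLq.coord_apply_unitVec_of_lt_two`). It suffices to consider unit vectors `w`, for
which only one coordinate of `x + t w` varies.

In both cases, strict monotonicity of the norm shows that the restriction of every `y ∈ Y` to the
support of every `x ∈ Y` is again in `Y` (`LpLq.apply_band_of_disjoint`). Then the index sets `A`
whose band projection maps `Y` into itself form a σ-algebra containing the supports of all elements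
of `Y`. The restriction of `Y` to each atom is at most one-dimensional, and spanning vectors of
these restrictions form an unconditional basis of `Y` (`LpLq.HasBlockBasis.of_band_supp_mem`).
-/

open Filter Topology MeasureTheory Asymptotics

/-! ### Coordinates, unit vectors and band projections -/

namespace lp

variable {α : Type*} {E : α → Type*} [∀ i, NormedAddCommGroup (E i)] {p : ℝ≥0∞}

/-- The norm of `lp E p` is strictly monotone. -/
theorem norm_apply_eq_of_norm_le (hp : 0 < p.toReal) {f g : lp E p}
    (h : ∀ i, ‖f i‖ ≤ ‖g i‖) (hn : ‖g‖ ≤ ‖f‖) (i : α) : ‖f i‖ = ‖g i‖ := by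
  refine (h i).eq_of_not_lt fun hlt => ?_
  have key : ∑' i, ‖f i‖ ^ p.toReal < ∑' i, ‖g i‖ ^ p.toReal :=
    Summable.tsum_lt_tsum (i := i)
      (fun j => Real.rpow_le_rpow (norm_nonneg _) (h j) hp.le)
      (Real.rpow_lt_rpow (norm_nonneg _) hlt hp)
      ((lp.memℓp f).summable hp) ((lp.memℓp g).summable hp)
  rw [← lp.norm_rpow_eq_tsum hp, ← lp.norm_rpow_eq_tsum hp] at key
  exact key.not_ge (Real.rpow_le_rpow (lp.norm_nonneg' _) hn hp.le)

theorem norm_add_single_rpow [DecidableEq α] (hp : 0 < p.toReal) (f : lp E p) (i : α) (a : E i) :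
    ‖f + lp.single p i a‖ ^ p.toReal =
      ‖f‖ ^ p.toReal - ‖f i‖ ^ p.toReal + ‖f i + a‖ ^ p.toReal := by
  have h := (lp.hasSum_norm hp f).update i (‖f i + a‖ ^ p.toReal)
  have h2 := lp.hasSum_norm hp (f + lp.single p i a)
  refine (h2.unique ?_).trans (by ring : ‖f i + a‖ ^ p.toReal - ‖f i‖ ^ p.toReal + ‖f‖ ^ p.toReal
    = _)
  convert! h using 1
  ext j
  by_cases hj : j = i
  · subst hj
    simp
  · simp [lp.single_apply, hj]

end lp

namespace LpLq

variable {p q : ℝ≥0∞} [Fact (1 ≤ p)] [Fact (1 ≤ q)]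

/-- The coordinate functional of `ℓ_p(ℓ_q)` at the index `i`. -/
noncomputable def coord (i : ℕ × ℕ) : LpLq p q →L[ℝ] ℝ :=
  (lp.evalCLM ℝ (fun _ : ℕ => ℝ) q i.2).comp
    (lp.evalCLM ℝ (fun _ : ℕ => lp (fun _ : ℕ => ℝ) q) p i.1)

theorem coord_apply (i : ℕ × ℕ) (x : LpLq p q) : coord i x = x i.1 i.2 := rfl

theorem mem_supp {x : LpLq p q} {i : ℕ × ℕ} : i ∈ supp x ↔ coord i x ≠ 0 := Iff.rfl

theorem ext_coord {x y : LpLq p q} (h : ∀ i, coord i x = coord i y) : x = y := by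
  refine lp.ext (funext fun k => lp.ext (funext fun l => ?_))
  exact h (k, l)

/-- The standard unit vector of `ℓ_p(ℓ_q)` at the index `i`. -/
noncomputable def unitVec (i : ℕ × ℕ) : LpLq p q :=
  lp.single p i.1 (lp.single q i.2 (1 : ℝ))

theorem coord_unitVec (i j : ℕ × ℕ) :
    coord i (unitVec j : LpLq p q) = if i = j then 1 else 0 := by
  obtain ⟨k, l⟩ := i
  obtain ⟨k', l'⟩ := j
  simp only [coord_apply, unitVec, lp.single_apply]
  by_cases hk : k = k'
  · subst hk
    by_cases hl : l = l'
    · subst hl; simp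
    · simp [hl, lp.single_apply]
  · simp [hk]

theorem norm_le_of_abs_coord_le {x y : LpLq p q} (h : ∀ i, |coord i x| ≤ |coord i y|) :
    ‖x‖ ≤ ‖y‖ :=
  lp.norm_mono (zero_lt_one.trans_le (Fact.out : 1 ≤ p)).ne' fun k =>
    lp.norm_mono (zero_lt_one.trans_le (Fact.out : 1 ≤ q)).ne' fun l => h (k, l)

theorem norm_eq_of_abs_coord_eq {x y : LpLq p q} (h : ∀ i, |coord i x| = |coord i y|) :
    ‖x‖ = ‖y‖ :=
  le_antisymm (norm_le_of_abs_coord_le fun i => (h i).le)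
    (norm_le_of_abs_coord_le fun i => (h i).ge)

/-- The norm of `ℓ_p(ℓ_q)`, `p, q < ∞`, is strictly monotone. -/
theorem abs_coord_eq_of_norm_le (hp : 0 < p.toReal) (hq : 0 < q.toReal) {x y : LpLq p q}
    (h : ∀ i, |coord i x| ≤ |coord i y|) (hn : ‖y‖ ≤ ‖x‖) (i : ℕ × ℕ) :
    |coord i x| = |coord i y| := by
  have h1 : ∀ k, ‖x k‖ ≤ ‖y k‖ := fun k =>
    lp.norm_mono (zero_lt_one.trans_le (Fact.out : 1 ≤ q)).ne' fun l => h (k, l)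
  exact lp.norm_apply_eq_of_norm_le hq (fun l => h (i.1, l))
    (lp.norm_apply_eq_of_norm_le hp h1 hn i.1).ge i.2

open scoped Classical in
/-- The band projection onto the vectors supported in `A`, which replaces the coordinates outside
of `A` by zero. -/
noncomputable def band (A : Set (ℕ × ℕ)) : LpLq p q →L[ℝ] LpLq p q :=
  have hq (x : LpLq p q) (k : ℕ) : Memℓp (fun l => if (k, l) ∈ A then x k l else 0) q :=
    (lp.memℓp (x k)).mono' fun l => by
      split_ifs <;> simp
  LinearMap.mkContinuous
    { toFun := fun x =>
        ⟨fun k => ⟨fun l => if (k, l) ∈ A then x k l else 0, hq x k⟩,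
          (lp.memℓp x).mono' fun k =>
            lp.norm_mono (zero_lt_one.trans_le (Fact.out : 1 ≤ q)).ne' fun l => by
              change ‖if (k, l) ∈ A then x k l else 0‖ ≤ _
              split_ifs <;> simp⟩
      map_add' := fun x y => by
        refine ext_coord fun i => ?_
        change (if i ∈ A then coord i (x + y) else 0) =
          (if i ∈ A then coord i x else 0) + (if i ∈ A then coord i y else 0)
        split_ifs <;> simp
      map_smul' := fun c x => by
        refine ext_coord fun i => ?_
        change (if i ∈ A then coord i (c • x) else 0) = c * (if i ∈ A then coord i x else 0)
        split_ifs <;> simp }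
    1 fun x => by
      rw [one_mul]
      refine norm_le_of_abs_coord_le fun i => ?_
      change |if i ∈ A then coord i x else 0| ≤ _
      split_ifs <;> simp

open scoped Classical in
theorem coord_band (A : Set (ℕ × ℕ)) (x : LpLq p q) (i : ℕ × ℕ) :
    coord i (band A x) = if i ∈ A then coord i x else 0 := rfl

theorem coord_band_of_mem {A : Set (ℕ × ℕ)} {i : ℕ × ℕ} (hi : i ∈ A) (x : LpLq p q) :
    coord i (band A x) = coord i x := by
  rw [coord_band, if_pos hi]

theorem coord_band_of_notMem {A : Set (ℕ × ℕ)} {i : ℕ × ℕ} (hi : i ∉ A) (x : LpLq p q) :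
    coord i (band A x) = 0 := by
  rw [coord_band, if_neg hi]

theorem norm_band_le (A : Set (ℕ × ℕ)) (x : LpLq p q) : ‖band A x‖ ≤ ‖x‖ := by
  refine norm_le_of_abs_coord_le fun i => ?_
  rw [coord_band]
  split_ifs <;> simp

theorem band_eq_self_of_norm_le (hp : 0 < p.toReal) (hq : 0 < q.toReal) {A : Set (ℕ × ℕ)}
    {x : LpLq p q} (h : ‖x‖ ≤ ‖band A x‖) : band A x = x := by
  have key := abs_coord_eq_of_norm_le hp hq (x := band A x) (y := x)
    (fun i => by rw [coord_band]; split_ifs <;> simp) h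
  refine ext_coord fun i => ?_
  have := key i
  rw [coord_band] at this ⊢
  split_ifs at this ⊢ with hi
  · rfl
  · exact (abs_eq_zero.1 (by simpa using this.symm)).symm

theorem band_unitVec_of_mem {A : Set (ℕ × ℕ)} {j : ℕ × ℕ} (hj : j ∈ A) :
    band A (unitVec j : LpLq p q) = unitVec j := by
  refine ext_coord fun i => ?_
  rw [coord_band, coord_unitVec]
  grind

theorem band_unitVec_of_notMem {A : Set (ℕ × ℕ)} {j : ℕ × ℕ} (hj : j ∉ A) :
    band A (unitVec j : LpLq p q) = 0 := by
  refine ext_coord fun i => ?_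
  rw [coord_band, coord_unitVec, map_zero]
  grind

theorem continuousLinearMap_ext {F : Type*} [NormedAddCommGroup F] [NormedSpace ℝ F]
    (hp : p ≠ ⊤) (hq : q ≠ ⊤) {f g : LpLq p q →L[ℝ] F}
    (h : ∀ j, f (unitVec j) = g (unitVec j)) : f = g := by
  refine lp.ext_continuousLinearMap hp fun k => lp.ext_continuousLinearMap hq fun l => ?_
  ext
  exact h (k, l)

theorem topologicalClosure_span_unitVec (hp : p ≠ ⊤) (hq : q ≠ ⊤) :
    (Submodule.span ℝ (Set.range (unitVec : ℕ × ℕ → LpLq p q))).topologicalClosure = ⊤ := by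
  refine eq_top_iff.2 fun x _ => ?_
  set S := (Submodule.span ℝ (Set.range (unitVec : ℕ × ℕ → LpLq p q))).topologicalClosure
  have hS : IsClosed (S : Set (LpLq p q)) := Submodule.isClosed_topologicalClosure _
  refine hS.mem_of_tendsto (lp.hasSum_single hp x) (Eventually.of_forall fun s => ?_)
  refine S.sum_mem fun k _ => ?_
  have h := (lp.hasSum_single hq (x k)).map
    (lp.singleContinuousLinearMap ℝ (fun _ : ℕ => lp (fun _ : ℕ => ℝ) q) p k)
    (lp.singleContinuousLinearMap ℝ (fun _ : ℕ => lp (fun _ : ℕ => ℝ) q) p k).continuous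
  refine hS.mem_of_tendsto h (Eventually.of_forall fun s => ?_)
  refine S.sum_mem fun l _ => ?_
  have : (lp.single p k (lp.single q l (x k l)) : LpLq p q) = x k l • unitVec (k, l) := by
    rw [unitVec, ← lp.single_smul, ← lp.single_smul, smul_eq_mul, mul_one]
  simp only [Function.comp_apply, lp.singleContinuousLinearMap_apply]
  rw [this]
  exact S.smul_mem _ (Submodule.le_topologicalClosure _ (Submodule.subset_span ⟨_, rfl⟩))

/-- Band projections depend continuously, in the strong operator topology, on the set, for
pointwise convergence of sets. -/
theorem tendsto_band (hp : p ≠ ⊤) (hq : q ≠ ⊤) {ι : Type*} {l : Filter ι}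
    {A : ι → Set (ℕ × ℕ)} {B : Set (ℕ × ℕ)} (h : ∀ i, ∀ᶠ a in l, (i ∈ A a ↔ i ∈ B))
    (x : LpLq p q) : Tendsto (fun a => band (A a) x) l (𝓝 (band B x)) := by
  have hspan : ∀ y ∈ Submodule.span ℝ (Set.range (unitVec : ℕ × ℕ → LpLq p q)),
      ∀ᶠ a in l, band (A a) y = band B y := by
    intro y hy
    induction hy using Submodule.span_induction with
    | mem y hy =>
      obtain ⟨j, rfl⟩ := hy
      filter_upwards [h j] with a ha
      by_cases hj : j ∈ B
      · rw [band_unitVec_of_mem hj, band_unitVec_of_mem (ha.2 hj)]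
      · rw [band_unitVec_of_notMem hj, band_unitVec_of_notMem (mt ha.1 hj)]
    | zero => simp
    | add y z _ _ hy hz =>
      filter_upwards [hy, hz] with a h1 h2
      rw [map_add, map_add, h1, h2]
    | smul c y _ hy =>
      filter_upwards [hy] with a h1
      rw [map_smul, map_smul, h1]
  have hx : x ∈ closure
      (Submodule.span ℝ (Set.range (unitVec : ℕ × ℕ → LpLq p q)) : Set (LpLq p q)) := by
    rw [← Submodule.topologicalClosure_coe, topologicalClosure_span_unitVec hp hq]
    trivial
  rw [Metric.tendsto_nhds]
  intro ε hε
  obtain ⟨y, hy, hxy⟩ := Metric.mem_closure_iff.1 hx (ε / 2) (half_pos hε)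
  filter_upwards [hspan y hy] with a ha
  have e : band (A a) x - band B x = band (A a) (x - y) - band B (x - y) := by
    rw [map_sub, map_sub, ha]
    abel
  rw [dist_eq_norm, e]
  rw [dist_eq_norm] at hxy
  have h1 := norm_sub_le (band (A a) (x - y)) (band B (x - y))
  linarith [norm_band_le (A a) (x - y), norm_band_le B (x - y)]

end LpLq

/-! ### Block bases from stability under band projections -/

namespace LpLq

variable {p q : ℝ≥0∞} [Fact (1 ≤ p)] [Fact (1 ≤ q)]

theorem band_union (A B : Set (ℕ × ℕ)) (x : LpLq p q) :
    band (A ∪ B) x = band A x + band B x - band A (band B x) := by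
  refine ext_coord fun i => ?_
  simp only [map_add, map_sub, coord_band, Set.mem_union]
  by_cases hA : i ∈ A <;> by_cases hB : i ∈ B <;> simp [hA, hB]

theorem band_compl (A : Set (ℕ × ℕ)) (x : LpLq p q) : band Aᶜ x = x - band A x := by
  refine ext_coord fun i => ?_
  simp only [map_sub, coord_band, Set.mem_compl_iff]
  by_cases hA : i ∈ A <;> simp [hA]

theorem band_empty (x : LpLq p q) : band ∅ x = 0 := by
  refine ext_coord fun i => ?_
  simp [coord_band]

/-- The σ-algebra of all sets `A` of indices such that the band projection onto `A` maps the closed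
subspace `Y` into itself. -/
abbrev bandInvariant (hp : p ≠ ⊤) (hq : q ≠ ⊤) (Y : Submodule ℝ (LpLq p q))
    (hY : IsClosed (Y : Set (LpLq p q))) : MeasurableSpace (ℕ × ℕ) where
  MeasurableSet' A := ∀ y ∈ Y, band A y ∈ Y
  measurableSet_empty y _ := by
    rw [band_empty]
    exact Y.zero_mem
  measurableSet_compl A hA y hy := by
    rw [band_compl]
    exact Y.sub_mem hy (hA y hy)
  measurableSet_iUnion A hA y hy := by
    have hfin : ∀ n, band (⋃ m ∈ Finset.range n, A m) y ∈ Y := by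
      intro n
      induction n with
      | zero => simp [band_empty]
      | succ n ih =>
        rw [Finset.range_add_one, Finset.set_biUnion_insert, band_union]
        exact Y.sub_mem (Y.add_mem (hA n y hy) ih) (hA n _ ih)
    refine hY.mem_of_tendsto (tendsto_band hp hq (l := atTop) (fun i => ?_) y)
      (Eventually.of_forall hfin)
    by_cases hi : ∃ m, i ∈ A m
    · obtain ⟨m, hm⟩ := hi
      filter_upwards [eventually_gt_atTop m] with n hn
      simp only [Set.mem_iUnion, Finset.mem_range]
      exact ⟨fun _ => ⟨m, hm⟩, fun _ => ⟨m, hn, hm⟩⟩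
    · refine Eventually.of_forall fun n => ?_
      simp only [Set.mem_iUnion]
      exact ⟨fun ⟨m, _, hm⟩ => ⟨m, hm⟩, fun h => (hi h).elim⟩

theorem HasBlockBasis.of_unconditionalSchauderBasis {Y : Submodule ℝ (LpLq p q)} {ι : Type*}
    [Countable ι] (b : UnconditionalSchauderBasis ι ℝ Y)
    (hb : ∀ i j, i ≠ j → Disjoint (supp (b i : LpLq p q)) (supp (b j : LpLq p q))) :
    HasBlockBasis Y := by
  classical
  rcases finite_or_infinite ι with hfin | hinf
  · left
    cases nonempty_fintype ι
    have hspan : ⊤ ≤ Submodule.span ℝ (Set.range b.basis) := by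
      intro y _
      have h1 : HasSum (fun i => b.coord i y • b.basis i) y := b.expansion y
      rw [← h1.tsum_eq, tsum_fintype]
      exact Submodule.sum_mem _ fun i _ =>
        Submodule.smul_mem _ _ (Submodule.subset_span ⟨i, rfl⟩)
    let e := Fintype.equivFin ι
    refine ⟨Fintype.card ι, (Module.Basis.mk b.linearIndependent hspan).reindex e,
      fun i j hij => ?_⟩
    simpa using hb (e.symm i) (e.symm j) (e.symm.injective.ne hij)
  · right
    obtain ⟨e⟩ : Nonempty (ℕ ≃ ι) := by
      cases nonempty_encodable ι
      cases nonempty_denumerable_iff.2 ⟨inferInstance, hinf⟩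
      exact ⟨(Denumerable.eqv ι).symm⟩
    refine ⟨{ basis := fun n => b.basis (e n)
              coord := fun n => b.coord (e n)
              ortho := fun m n => ?_
              expansion := fun y => ?_ }, fun i j hij => hb _ _ (e.injective.ne hij)⟩
    · rw [b.ortho]
      simp [Pi.single_apply]
    · have h1 : HasSum (fun i => b.coord i y • b.basis i) y := b.expansion y
      have h2 := ((e.hasSum_iff).2 h1).tendsto_sum_nat
      rw [HasSum, SummationFilter.conditional_filter_eq_map_range]
      exact h2

/-- A closed subspace which is stable under the band projections onto the supports of its elements
has a block basis. The minimal supports are the atoms of the σ-algebra `bandInvariant`; two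
elements of the subspace are proportional on each atom, for otherwise a linear combination of them
would vanish on a part of it only. -/
theorem HasBlockBasis.of_band_supp_mem (hp : p ≠ ⊤) (hq : q ≠ ⊤) (Y : Submodule ℝ (LpLq p q))
    (hY : IsClosed (Y : Set (LpLq p q)))
    (h : ∀ x ∈ Y, ∀ y ∈ Y, band (supp x) y ∈ Y) : HasBlockBasis Y := by
  let _ := bandInvariant hp hq Y hY
  let P : ℕ × ℕ → Prop := fun i => ∃ y ∈ Y, coord i y ≠ 0
  let ι : Type := Set.range fun i : {i // P i} => measurableAtom i.1
  have hι : ∀ C : ι, ∃ i, ∃ y ∈ Y, coord i y ≠ 0 ∧ measurableAtom i = C.1 := by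
    rintro ⟨C, ⟨i, y, hy, hiy⟩, rfl⟩
    exact ⟨i, y, hy, hiy, rfl⟩
  choose i y hyY hy0 hiC using hι
  have hmem : ∀ C : ι, i C ∈ C.1 := fun C => by
    rw [← hiC C]
    exact mem_measurableAtom_self _
  have hmeas : ∀ C : ι, ∀ z ∈ Y, band C.1 z ∈ Y := fun C => by
    rw [← hiC C]
    exact MeasurableSet.measurableAtom_of_countable (i C)
  -- An element of `Y` that vanishes at one point of an atom vanishes on this atom.
  have hzero : ∀ C : ι, ∀ z ∈ Y, coord (i C) z = 0 → ∀ j ∈ C.1, coord j z = 0 := by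
    intro C z hz hz0 j hj
    have hs : MeasurableSet (supp z)ᶜ := MeasurableSet.compl (h z hz)
    rw [← hiC C] at hj
    have := mem_of_mem_measurableAtom hj hs (by simpa [mem_supp] using hz0)
    simpa [mem_supp] using this
  have heq : ∀ C D : ι, ∀ j, j ∈ C.1 → j ∈ D.1 → C = D := by
    intro C D j hC hD
    rw [← hiC C] at hC
    rw [← hiC D] at hD
    refine Subtype.ext ?_
    rw [← hiC C, ← hiC D, ← measurableAtom_eq_of_mem hC, ← measurableAtom_eq_of_mem hD]
  let b : ι → Y := fun C => ⟨band C.1 (y C), hmeas C _ (hyY C)⟩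
  let f : ι → StrongDual ℝ Y := fun C =>
    (coord (i C) (y C))⁻¹ • (coord (i C)).comp Y.subtypeL
  have hf : ∀ C, ∀ z : Y, f C z = (coord (i C) (y C))⁻¹ * coord (i C) (z : LpLq p q) :=
    fun C z => rfl
  have hband : ∀ C, ∀ z : Y, ((f C z • b C : Y) : LpLq p q) = band C.1 (z : LpLq p q) := by
    intro C z
    have h0 := hzero C (z - (f C z) • y C) (Y.sub_mem z.2 (Y.smul_mem _ (hyY C))) (by
      rw [map_sub, map_smul, hf, smul_eq_mul]
      field_simp [hy0 C]
      ring)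
    refine ext_coord fun j => ?_
    change coord j (f C z • band C.1 (y C)) = _
    rw [map_smul]
    by_cases hj : j ∈ C.1
    · have := h0 j hj
      rw [map_sub, map_smul] at this
      rw [coord_band_of_mem hj, coord_band_of_mem hj]
      linarith
    · rw [coord_band_of_notMem hj, coord_band_of_notMem hj, smul_zero]
  have hsub : ∀ C, supp (b C : LpLq p q) ⊆ C.1 := by
    intro C j hj
    by_contra hjC
    exact hj (coord_band_of_notMem hjC (y C))
  have : Countable ι := (Set.countable_range _).to_subtype
  let _ : DecidableEq ι := fun C D => Classical.propDecidable (C = D)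
  refine HasBlockBasis.of_unconditionalSchauderBasis (ι := ι)
    { basis := b
      coord := f
      ortho := fun C D => ?_
      expansion := fun z => ?_ } fun C D hCD => ?_
  · rw [hf]
    by_cases hCD : C = D
    · subst hCD
      change _ * coord (i C) (band C.1 (y C)) = _
      rw [coord_band_of_mem (hmem C), Pi.single_eq_same, inv_mul_cancel₀ (hy0 C)]
    · change _ * coord (i C) (band D.1 (y D)) = _
      rw [coord_band_of_notMem (fun hi => hCD (heq C D _ (hmem C) hi)), mul_zero,
        Pi.single_eq_of_ne hCD]
  · change HasSum (fun C => f C z • b C) z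
    rw [← Topology.IsInducing.hasSum_iff (g := Y.subtype) Topology.IsInducing.subtypeVal]
    have hsum : ∀ s : Finset ι, ∑ C ∈ s, ((Y.subtype ∘ fun C => f C z • b C) C) =
        band (⋃ C ∈ s, C.1) (z : LpLq p q) := by
      intro s
      refine ext_coord fun j => ?_
      rw [map_sum]
      have e : ∀ C : ι, coord j ((Y.subtype ∘ fun C => f C z • b C) C) =
          coord j (band C.1 (z : LpLq p q)) := fun C => by rw [← hband C z]; rfl
      rw [Finset.sum_congr rfl fun C _ => e C]
      by_cases hj : ∃ C ∈ s, j ∈ C.1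
      · obtain ⟨C, hC, hjC⟩ := hj
        rw [Finset.sum_eq_single_of_mem C hC fun D _ hD =>
          coord_band_of_notMem (fun hjD => hD (heq D C j hjD hjC)) _,
          coord_band_of_mem hjC, coord_band_of_mem (by simpa using ⟨C, hC, hjC⟩)]
      · rw [Finset.sum_eq_zero fun C hC =>
          coord_band_of_notMem (fun hjC => hj ⟨C, hC, hjC⟩) _,
          coord_band_of_notMem fun hj' => hj (by simpa using hj')]
    have hlim := tendsto_band hp hq (l := (atTop : Filter (Finset ι)))
      (A := fun s => ⋃ C ∈ s, C.1) (B := ⋃ C : ι, C.1) (fun j => by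
        by_cases hj : ∃ C : ι, j ∈ C.1
        · obtain ⟨C, hC⟩ := hj
          filter_upwards [eventually_ge_atTop {C}] with s hs
          refine iff_of_true ?_ (Set.mem_iUnion.2 ⟨C, hC⟩)
          exact Set.mem_biUnion (Finset.singleton_subset_iff.1 hs) hC
        · refine Eventually.of_forall fun s => iff_of_false ?_ ?_
          · simp only [Set.mem_iUnion]
            exact fun ⟨C, _, hC⟩ => hj ⟨C, hC⟩
          · simpa using hj) (z : LpLq p q)
    have hfull : band (⋃ C : ι, C.1) (z : LpLq p q) = z := by
      refine ext_coord fun j => ?_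
      by_cases hj : coord j (z : LpLq p q) = 0
      · rw [coord_band, hj, ite_self]
      · refine coord_band_of_mem (Set.mem_iUnion.2 ?_) _
        exact ⟨⟨measurableAtom j, ⟨j, z, z.2, hj⟩, rfl⟩, mem_measurableAtom_self j⟩
    rw [hfull] at hlim
    rw [HasSum, SummationFilter.unconditional_filter]
    exact hlim.congr fun s => (hsum s).symm
  · refine Set.disjoint_left.2 fun j hC hD => hCD (heq C D j (hsub C hC) (hsub D hD))

end LpLq

/-! ### Growth estimates on the real line and in `ℓ_q` -/

theorem ContDiffAt.isBigO_second_difference {f : ℝ → ℝ} (hf : ContDiffAt ℝ 2 f 0) :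
    (fun t => f t + f (-t) - 2 * f 0) =O[𝓝 0] fun t => t ^ 2 := by
  obtain ⟨u, hu, hfu⟩ := hf.contDiffOn (m := 2) le_rfl (by simp)
  obtain ⟨ε, hε, hball⟩ := Metric.mem_nhds_iff.1 hu
  have h0 : (0 : ℝ) ∈ Metric.ball (0 : ℝ) ε := Metric.mem_ball_self hε
  have h1 := taylor_isLittleO (n := 2) (convex_ball (0 : ℝ) ε) h0 (hfu.mono hball)
  rw [nhdsWithin_eq_nhds.2 (Metric.ball_mem_nhds _ hε)] at h1
  have hneg : Tendsto (fun t : ℝ => -t) (𝓝 0) (𝓝 0) := by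
    simpa using (continuous_neg (G := ℝ)).tendsto 0
  have h2 := h1.comp_tendsto hneg
  simp only [taylor_within_apply, sub_zero, Function.comp_def, even_two.neg_pow] at h1 h2
  set d := iteratedDerivWithin 2 f (Metric.ball 0 ε) 0
  have h3 : (fun t : ℝ => d * t ^ 2) =O[𝓝 0] fun t => t ^ 2 := isBigO_const_mul_self _ _ _
  refine ((h1.isBigO.add h2.isBigO).add h3).congr_left fun t => ?_
  simp only [Finset.sum_range_succ, Finset.sum_range_zero, iteratedDerivWithin_zero, d]
  simp
  ring

theorem isTheta_add_rpow_sub_rpow {A r : ℝ} (hA : 0 < A) (hr : 0 < r) :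
    (fun s : ℝ => (A + s) ^ r - A ^ r) =Θ[𝓝 0] fun s => s := by
  have hder : HasDerivAt (fun s : ℝ => (A + s) ^ r) (r * A ^ (r - 1)) 0 := by
    have := ((hasDerivAt_id (0 : ℝ)).const_add A).rpow_const (p := r)
      (Or.inl (by simpa using hA.ne'))
    simpa using this
  have hne : r * A ^ (r - 1) ≠ 0 := (mul_pos hr (Real.rpow_pos_of_pos hA _)).ne'
  have hθ : (fun s : ℝ => r * A ^ (r - 1) * s) =Θ[𝓝 0] fun s => s :=
    (isTheta_const_mul_left hne).2 (isTheta_refl _ _)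
  have hlo := hasDerivAt_iff_isLittleO.1 hder
  simp only [sub_zero, add_zero, smul_eq_mul] at hlo
  refine EventuallyEq.trans_isTheta (Eventually.of_forall fun s => ?_) (hθ.add_isLittleO hlo)
  simp only [Pi.add_apply]
  ring

/-- For `r = p / q` this is the increment of the `p`-th power of the norm of `ℓ_p(ℓ_q)` in the
direction of a unit vector at whose index the base point vanishes; `α` is the `q`-th power of the
norm of the corresponding block of the base point. The order is `t ^ p` if this block is zero, and
`t ^ q` otherwise. -/
theorem isTheta_add_abs_rpow_sub_rpow {α q r : ℝ} (hα : 0 ≤ α) (hq : 0 < q) (hr : 0 < r) {c : ℝ}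
    (hc : c ≠ 0) :
    (fun t : ℝ => (α + |t * c| ^ q) ^ r - α ^ r) =Θ[𝓝[>] 0]
      fun t => t ^ (if α = 0 then q * r else q) := by
  have habs : ∀ᶠ t : ℝ in 𝓝[>] 0, |t * c| ^ q = |c| ^ q * t ^ q := by
    filter_upwards [self_mem_nhdsWithin] with t ht
    rw [abs_mul, abs_of_pos (Set.mem_Ioi.1 ht), Real.mul_rpow (le_of_lt ht) (abs_nonneg c),
      mul_comm]
  have hcpos : 0 < |c| ^ q := Real.rpow_pos_of_pos (abs_pos.2 hc) q
  split_ifs with h0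
  · subst h0
    have : (fun t : ℝ => (0 + |t * c| ^ q) ^ r - 0 ^ r) =ᶠ[𝓝[>] 0]
        fun t => (|c| ^ q) ^ r * t ^ (q * r) := by
      filter_upwards [habs, self_mem_nhdsWithin] with t ht ht0
      have ht0 : (0 : ℝ) < t := ht0
      rw [ht, zero_add, Real.zero_rpow hr.ne', sub_zero, Real.mul_rpow hcpos.le (by positivity),
        ← Real.rpow_mul ht0.le]
    exact this.trans_isTheta
      ((isTheta_const_mul_left (Real.rpow_pos_of_pos hcpos r).ne').2 (isTheta_refl _ _))
  · have hα' : 0 < α := lt_of_le_of_ne hα (Ne.symm h0)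
    have hlim : Tendsto (fun t : ℝ => |c| ^ q * t ^ q) (𝓝[>] 0) (𝓝 0) := by
      have : ContinuousAt (fun t : ℝ => |c| ^ q * t ^ q) 0 :=
        continuousAt_const.mul (Real.continuousAt_rpow_const 0 q (Or.inr hq.le))
      have h := this.tendsto
      simp only [Real.zero_rpow hq.ne', mul_zero] at h
      exact h.mono_left nhdsWithin_le_nhds
    have h1 : ((fun s : ℝ => (α + s) ^ r - α ^ r) ∘ fun t : ℝ => |c| ^ q * t ^ q) =Θ[𝓝[>] 0]
        fun t : ℝ => |c| ^ q * t ^ q :=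
      ⟨(isTheta_add_rpow_sub_rpow hα' hr).1.comp_tendsto hlim,
        (isTheta_add_rpow_sub_rpow hα' hr).2.comp_tendsto hlim⟩
    have h2 : (fun t : ℝ => (α + |t * c| ^ q) ^ r - α ^ r) =ᶠ[𝓝[>] 0]
        (fun s : ℝ => (α + s) ^ r - α ^ r) ∘ fun t => |c| ^ q * t ^ q := by
      filter_upwards [habs] with t ht
      simp only [Function.comp, ht]
    exact h2.trans_isTheta (h1.trans ((isTheta_const_mul_left hcpos.ne').2 (isTheta_refl _ _)))

theorem not_isBigO_rpow_rpow {m n : ℝ} (h : m < n) :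
    ¬ (fun t : ℝ => t ^ m) =O[𝓝[>] 0] fun t => t ^ n := by
  intro hO
  have h1 : (fun t : ℝ => t ^ (n - m) * t ^ m) =o[𝓝[>] 0] fun t => 1 * t ^ m := by
    refine IsLittleO.mul_isBigO ?_ (isBigO_refl _ _)
    rw [isLittleO_one_iff]
    have := (Real.continuousAt_rpow_const 0 (n - m) (Or.inr (sub_pos.2 h).le)).tendsto
    rw [Real.zero_rpow (sub_pos.2 h).ne'] at this
    exact this.mono_left nhdsWithin_le_nhds
  have h2 : (fun t : ℝ => t ^ (n - m) * t ^ m) =ᶠ[𝓝[>] 0] fun t => t ^ n := by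
    filter_upwards [self_mem_nhdsWithin] with t ht
    rw [← Real.rpow_add ht, sub_add_cancel]
  have h3 := hO.trans_isLittleO (h1.congr' h2 (g₂ := fun t : ℝ => t ^ m) (by simp))
  refine isLittleO_irrefl ?_ h3
  refine Eventually.frequently ?_
  filter_upwards [self_mem_nhdsWithin] with t ht
  exact (Real.rpow_pos_of_pos ht m).ne'

theorem Real.half_add_rpow_le {a b r : ℝ} (ha : 0 ≤ a) (hb : 0 ≤ b) (hr : 1 ≤ r) :
    ((a + b) / 2) ^ r ≤ (a ^ r + b ^ r) / 2 := by
  have := (convexOn_rpow hr).2 (Set.mem_Ici.2 ha) (Set.mem_Ici.2 hb)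
    (by norm_num : (0 : ℝ) ≤ 1 / 2) (by norm_num : (0 : ℝ) ≤ 1 / 2) (by norm_num)
  simp only [smul_eq_mul] at this
  calc ((a + b) / 2) ^ r = (1 / 2 * a + 1 / 2 * b) ^ r := by ring_nf
    _ ≤ _ := this
    _ = _ := by ring

theorem norm_rpow_le_half_add {E : Type*} [NormedAddCommGroup E] [NormedSpace ℝ E] (x u : E)
    {r : ℝ} (hr : 1 ≤ r) : ‖x‖ ^ r ≤ (‖x + u‖ ^ r + ‖x - u‖ ^ r) / 2 := by
  refine le_trans ?_ (Real.half_add_rpow_le (norm_nonneg _) (norm_nonneg _) hr)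
  refine Real.rpow_le_rpow (norm_nonneg _) ?_ (by linarith)
  have h := norm_add_le (x + u) (x - u)
  have e : x + u + (x - u) = (2 : ℝ) • x := by rw [two_smul]; abel
  rw [e, norm_smul, Real.norm_two] at h
  linarith

/-- A consequence of the `2`-convexity of `ℓ_q`, `q ≥ 2`: the symmetrized square of the norm at `a`
in the direction `b` is bounded below by the contribution of a single coordinate `l` of `b`. It is
Minkowski's inequality in `ℓ_{q/2}` for the squares of `a + b` and `a - b`. -/
theorem lp.add_rpow_le_half_add_sq {ι : Type*} {q : ℝ≥0∞} [Fact (1 ≤ q)] (hq : 2 ≤ q.toReal)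
    (a b : lp (fun _ : ι => ℝ) q) (l : ι) :
    (‖a‖ ^ q.toReal + ((a l ^ 2 + b l ^ 2) ^ (q.toReal / 2) - (a l ^ 2) ^ (q.toReal / 2))) ^
      (2 / q.toReal) ≤ (‖a + b‖ ^ 2 + ‖a - b‖ ^ 2) / 2 := by
  classical
  have hq0 : 0 < q.toReal := by linarith
  have hQ : 1 ≤ q.toReal / 2 := by linarith
  have hsq : ∀ s : ℝ, (s ^ 2) ^ (q.toReal / 2) = |s| ^ q.toReal := fun s => by
    rw [← sq_abs, ← Real.rpow_natCast, ← Real.rpow_mul (abs_nonneg s)]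
    congr 1
    push_cast
    ring
  have hhalf : ∀ f : lp (fun _ : ι => ℝ) q,
      HasSum (fun i => (f i ^ 2 / 2) ^ (q.toReal / 2))
        (‖f‖ ^ q.toReal / 2 ^ (q.toReal / 2)) := fun f => by
    have h := (lp.hasSum_norm hq0 f).div_const (2 ^ (q.toReal / 2))
    refine h.congr_fun fun i => ?_
    rw [Real.div_rpow (sq_nonneg _) zero_le_two, hsq, Real.norm_eq_abs]
  have hroot : ∀ f : lp (fun _ : ι => ℝ) q,
      (‖f‖ ^ q.toReal / 2 ^ (q.toReal / 2)) ^ (1 / (q.toReal / 2)) = ‖f‖ ^ 2 / 2 := fun f => by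
    have e : q.toReal * (1 / (q.toReal / 2)) = (2 : ℕ) := by field_simp; norm_num
    have e2 : q.toReal / 2 * (1 / (q.toReal / 2)) = 1 := by field_simp
    rw [Real.div_rpow (by positivity) (by positivity), ← Real.rpow_mul (norm_nonneg _),
      ← Real.rpow_mul zero_le_two, e, e2, Real.rpow_natCast, Real.rpow_one]
  obtain ⟨hsum, hle⟩ := Real.Lp_add_le_tsum_of_nonneg hQ
    (f := fun i => (a + b) i ^ 2 / 2) (g := fun i => (a - b) i ^ 2 / 2)
    (fun i => by positivity) (fun i => by positivity)
    (hhalf (a + b)).summable (hhalf (a - b)).summable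
  rw [(hhalf (a + b)).tsum_eq, (hhalf (a - b)).tsum_eq, hroot, hroot] at hle
  have hval : ∀ i, (a + b) i ^ 2 / 2 + (a - b) i ^ 2 / 2 = a i ^ 2 + b i ^ 2 := fun i => by
    rw [lp.coeFn_add, lp.coeFn_sub, Pi.add_apply, Pi.sub_apply]
    ring
  simp only [hval] at hsum hle
  have hupd := (lp.hasSum_norm hq0 a).update l ((a l ^ 2 + b l ^ 2) ^ (q.toReal / 2))
  have hcmp : ‖a‖ ^ q.toReal +
      ((a l ^ 2 + b l ^ 2) ^ (q.toReal / 2) - (a l ^ 2) ^ (q.toReal / 2)) ≤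
        ∑' i, (a i ^ 2 + b i ^ 2) ^ (q.toReal / 2) := by
    refine le_trans (le_of_eq ?_) (hasSum_le (fun i => ?_) hupd hsum.hasSum)
    · rw [hsq, Real.norm_eq_abs]
      ring
    · by_cases hi : i = l
      · subst hi
        simp
      · rw [Function.update_of_ne hi, Real.norm_eq_abs, ← hsq]
        exact Real.rpow_le_rpow (sq_nonneg _) (by nlinarith [sq_nonneg (b i)]) (by linarith)
  have hnn : 0 ≤ ‖a‖ ^ q.toReal +
      ((a l ^ 2 + b l ^ 2) ^ (q.toReal / 2) - (a l ^ 2) ^ (q.toReal / 2)) := by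
    have : (a l ^ 2) ^ (q.toReal / 2) ≤ (a l ^ 2 + b l ^ 2) ^ (q.toReal / 2) :=
      Real.rpow_le_rpow (sq_nonneg _) (by nlinarith [sq_nonneg (b l)]) (by linarith)
    have := Real.rpow_nonneg (norm_nonneg a) q.toReal
    linarith
  calc _ ≤ (∑' i, (a i ^ 2 + b i ^ 2) ^ (q.toReal / 2)) ^ (2 / q.toReal) :=
        Real.rpow_le_rpow hnn hcmp (by positivity)
    _ = (∑' i, (a i ^ 2 + b i ^ 2) ^ (q.toReal / 2)) ^ (1 / (q.toReal / 2)) := by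
        congr 1
        field_simp
    _ ≤ ‖a + b‖ ^ 2 / 2 + ‖a - b‖ ^ 2 / 2 := hle
    _ = _ := by ring

/-- The version of `lp.add_rpow_le_half_add_sq` for the `p`-th power of the norm of `ℓ_q`. -/
theorem lp.add_rpow_le_half_add_rpow {ι : Type*} {q : ℝ≥0∞} [Fact (1 ≤ q)] (hq : 2 ≤ q.toReal) {p : ℝ}
    (hp : 2 ≤ p) (a b : lp (fun _ : ι => ℝ) q) (l : ι) :
    (‖a‖ ^ q.toReal + ((a l ^ 2 + b l ^ 2) ^ (q.toReal / 2) - (a l ^ 2) ^ (q.toReal / 2))) ^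
      (p / q.toReal) ≤ (‖a + b‖ ^ p + ‖a - b‖ ^ p) / 2 := by
  have hq0 : 0 < q.toReal := by linarith
  have hnn : 0 ≤ ‖a‖ ^ q.toReal +
      ((a l ^ 2 + b l ^ 2) ^ (q.toReal / 2) - (a l ^ 2) ^ (q.toReal / 2)) := by
    have : (a l ^ 2) ^ (q.toReal / 2) ≤ (a l ^ 2 + b l ^ 2) ^ (q.toReal / 2) :=
      Real.rpow_le_rpow (sq_nonneg _) (by nlinarith [sq_nonneg (b l)]) (by linarith)
    have := Real.rpow_nonneg (norm_nonneg a) q.toReal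
    linarith
  have h := Real.rpow_le_rpow (by positivity) (lp.add_rpow_le_half_add_sq hq a b l)
    (by linarith : 0 ≤ p / 2)
  have e : 2 / q.toReal * (p / 2) = p / q.toReal := by field_simp
  have hpow : ∀ s : ℝ, 0 ≤ s → (s ^ 2) ^ (p / 2) = s ^ p := fun s hs => by
    rw [← Real.rpow_natCast, ← Real.rpow_mul hs]
    congr 1
    push_cast
    ring
  rw [← Real.rpow_mul hnn, e] at h
  refine h.trans ((Real.half_add_rpow_le (sq_nonneg _) (sq_nonneg _) (by linarith)).trans ?_)
  rw [hpow _ (norm_nonneg _), hpow _ (norm_nonneg _)]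

/-! ### Contractive projections and bands -/

namespace LpLq

variable {p q : ℝ≥0∞} [Fact (1 ≤ p)] [Fact (1 ≤ q)]

theorem norm_add_smul_unitVec_rpow (hp : 0 < p.toReal) (hq : 0 < q.toReal) (x : LpLq p q)
    (j : ℕ × ℕ) (t : ℝ) :
    ‖x + t • unitVec j‖ ^ p.toReal = ‖x‖ ^ p.toReal - ‖x j.1‖ ^ p.toReal +
      (‖x j.1‖ ^ q.toReal - |coord j x| ^ q.toReal + |coord j x + t| ^ q.toReal) ^
        (p.toReal / q.toReal) := by
  have e : (t • unitVec j : LpLq p q) = lp.single p j.1 (lp.single q j.2 t) := by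
    rw [unitVec, ← lp.single_smul, ← lp.single_smul, smul_eq_mul, mul_one]
  have h := lp.norm_add_single_rpow hq (x j.1) j.2 t
  rw [e, lp.norm_add_single_rpow hp, coord_apply, ← Real.norm_eq_abs, ← Real.norm_eq_abs, ← h,
    ← Real.rpow_mul (norm_nonneg _), mul_div_cancel₀ _ hq.ne']

theorem norm_add_smul_unitVec_rpow_of_coord_eq_zero (hp : 0 < p.toReal) (hq : 0 < q.toReal)
    {x : LpLq p q} {j : ℕ × ℕ} (hj : coord j x = 0) (t : ℝ) :
    ‖x + t • unitVec j‖ ^ p.toReal = ‖x‖ ^ p.toReal +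
      ((‖x j.1‖ ^ q.toReal + |t| ^ q.toReal) ^ (p.toReal / q.toReal) -
        (‖x j.1‖ ^ q.toReal) ^ (p.toReal / q.toReal)) := by
  rw [norm_add_smul_unitVec_rpow hp hq, hj, abs_zero, Real.zero_rpow hq.ne',
    ← Real.rpow_mul (norm_nonneg _), mul_div_cancel₀ _ hq.ne', sub_zero, zero_add]
  ring

/-- In the direction of a unit vector in the support of `x`, the `p`-th power of the norm is smooth
at `x`, for every `p` and `q`: only one coordinate varies, and it stays away from zero. -/
theorem isBigO_second_difference_norm_rpow (hp : 0 < p.toReal) (hq : 0 < q.toReal) {x : LpLq p q}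
    {j : ℕ × ℕ} (hj : coord j x ≠ 0) :
    (fun t : ℝ => ‖x + t • unitVec j‖ ^ p.toReal + ‖x - t • unitVec j‖ ^ p.toReal -
      2 * ‖x‖ ^ p.toReal) =O[𝓝 0] fun t => t ^ 2 := by
  have hx : 0 ≤ ‖x j.1‖ ^ q.toReal - |coord j x| ^ q.toReal :=
    sub_nonneg.2 (Real.rpow_le_rpow (abs_nonneg _)
      (lp.norm_apply_le_norm (zero_lt_one.trans_le (Fact.out : 1 ≤ q)).ne' (x j.1) j.2) hq.le)
  have habs : ContDiffAt ℝ 2 (fun t : ℝ => |coord j x + t|) 0 :=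
    (contDiffAt_const.add contDiffAt_id).abs (by simpa using hj)
  have hsm : ContDiffAt ℝ 2 (fun t : ℝ => ‖x + t • unitVec j‖ ^ p.toReal) 0 := by
    simp only [norm_add_smul_unitVec_rpow hp hq]
    refine contDiffAt_const.add (ContDiffAt.rpow_const_of_ne (contDiffAt_const.add
      (habs.rpow_const_of_ne (by simpa using hj))) (ne_of_gt ?_))
    have : 0 < |coord j x + 0| ^ q.toReal :=
      Real.rpow_pos_of_pos (abs_pos.2 (by simpa using hj)) _
    linarith
  simpa [sub_eq_add_neg] using hsm.isBigO_second_difference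

/-- Perturbing a fixed point `x` of a contraction `P` by `P y` costs at most as much norm as
perturbing it by `y`. -/
theorem norm_add_apply_le {P : LpLq p q →L[ℝ] LpLq p q} (hP : ‖P‖ ≤ 1) {x : LpLq p q}
    (hx : P x = x) (y : LpLq p q) : ‖x + P y‖ ≤ ‖x + y‖ := by
  calc ‖x + P y‖ = ‖P (x + y)‖ := by rw [map_add, hx]
    _ ≤ 1 * ‖x + y‖ := P.le_of_opNorm_le hP _
    _ = _ := one_mul _

/-- For `p, q > 2`, a contractive operator fixing `x` maps vectors disjoint from `x` to vectors
disjoint from `x`. Indeed, in the direction of a unit vector disjoint from `x` the `p`-th power of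
the norm grows from `x` at the rate `o(t ^ 2)`, while in directions which are not disjoint from `x`
its symmetrized growth is at least of the order `t ^ 2`. -/
theorem coord_apply_unitVec_of_two_lt (hp : 2 < p.toReal) (hq : 2 < q.toReal)
    {P : LpLq p q →L[ℝ] LpLq p q} (hP : ‖P‖ ≤ 1) {x : LpLq p q} (hx : P x = x) {i j : ℕ × ℕ}
    (hi : coord i x ≠ 0) (hj : coord j x = 0) : coord i (P (unitVec j)) = 0 := by
  by_contra hu
  have hp0 : 0 < p.toReal := by linarith
  have hq0 : 0 < q.toReal := by linarith
  have hr0 : 0 < p.toReal / q.toReal := div_pos hp0 hq0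
  set u := P (unitVec j) with hudef
  set r := p.toReal / q.toReal with hr
  let D : ℝ → ℝ := fun t =>
    ((x i.1 i.2) ^ 2 + (t * u i.1 i.2) ^ 2) ^ (q.toReal / 2) - ((x i.1 i.2) ^ 2) ^ (q.toReal / 2)
  let A : ℝ := ‖x i.1‖ ^ q.toReal
  have hAr : A ^ r = ‖x i.1‖ ^ p.toReal := by
    rw [hr, ← Real.rpow_mul (norm_nonneg _), mul_div_cancel₀ _ hq0.ne']
  have hA : 0 < A := by
    refine Real.rpow_pos_of_pos (norm_pos_iff.2 fun h => hi ?_) _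
    rw [coord_apply, h]
    rfl
  have hlower : ∀ t : ℝ, ‖x‖ ^ p.toReal + ((A + D t) ^ r - A ^ r) ≤
      (‖x + t • u‖ ^ p.toReal + ‖x - t • u‖ ^ p.toReal) / 2 := by
    intro t
    -- The block containing the index `i` is treated separately, by replacing it with zero.
    have hblock : ∀ y : LpLq p q, ‖y + lp.single p i.1 (-(y i.1))‖ ^ p.toReal =
        ‖y‖ ^ p.toReal - ‖y i.1‖ ^ p.toReal := fun y => by
      rw [lp.norm_add_single_rpow hp0, add_neg_cancel, norm_zero, Real.zero_rpow hp0.ne', add_zero]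
    have h1 := norm_rpow_le_half_add (x + lp.single p i.1 (-(x i.1)))
      (t • u + lp.single p i.1 (-((t • u : LpLq p q) i.1))) (r := p.toReal) (by linarith)
    have e1 : x + lp.single p i.1 (-(x i.1)) +
        (t • u + lp.single p i.1 (-((t • u : LpLq p q) i.1))) =
        (x + t • u) + lp.single p i.1 (-((x + t • u : LpLq p q) i.1)) := by
      rw [lp.coeFn_add, Pi.add_apply, neg_add, lp.single_add]
      abel
    have e2 : x + lp.single p i.1 (-(x i.1)) -
        (t • u + lp.single p i.1 (-((t • u : LpLq p q) i.1))) =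
        (x - t • u) + lp.single p i.1 (-((x - t • u : LpLq p q) i.1)) := by
      rw [lp.coeFn_sub, Pi.sub_apply, neg_sub', lp.single_sub]
      abel
    rw [e1, e2, hblock, hblock, hblock] at h1
    have h2 := lp.add_rpow_le_half_add_rpow hq.le hp.le (x i.1) ((t • u : LpLq p q) i.1) i.2
    have e3 : ((t • u : LpLq p q) i.1) i.2 = t * u i.1 i.2 := rfl
    rw [e3] at h2
    change (A + D t) ^ r ≤ _ at h2
    have e4 : (x + t • u : LpLq p q) i.1 = x i.1 + (t • u : LpLq p q) i.1 := rfl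
    have e5 : (x - t • u : LpLq p q) i.1 = x i.1 - (t • u : LpLq p q) i.1 := rfl
    rw [e4, e5] at h1
    linarith
  have hcontr : ∀ t : ℝ, ‖x + t • u‖ ^ p.toReal ≤ ‖x‖ ^ p.toReal +
      ((‖x j.1‖ ^ q.toReal + |t| ^ q.toReal) ^ r - (‖x j.1‖ ^ q.toReal) ^ r) := by
    intro t
    rw [← norm_add_smul_unitVec_rpow_of_coord_eq_zero hp0 hq0 hj, hudef, ← map_smul]
    exact Real.rpow_le_rpow (norm_nonneg _) (norm_add_apply_le hP hx _) hp0.le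
  have hle : ∀ t : ℝ, (A + D t) ^ r - A ^ r ≤
      (‖x j.1‖ ^ q.toReal + |t * 1| ^ q.toReal) ^ r - (‖x j.1‖ ^ q.toReal) ^ r := by
    intro t
    have h1 := hlower t
    have h2 := hcontr t
    have h3 := hcontr (-t)
    rw [abs_neg, neg_smul, ← sub_eq_add_neg] at h3
    rw [mul_one]
    linarith
  have ha : 0 < (x i.1 i.2) ^ 2 := by
    have : x i.1 i.2 ≠ 0 := hi
    positivity
  have hlim : Tendsto (fun t : ℝ => (t * u i.1 i.2) ^ 2) (𝓝[>] 0) (𝓝 0) := by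
    have : Continuous fun t : ℝ => (t * u i.1 i.2) ^ 2 := by fun_prop
    simpa using (this.tendsto 0).mono_left (nhdsWithin_le_nhds (s := Set.Ioi 0))
  have hDθ : D =Θ[𝓝[>] 0] fun t => t ^ (2 : ℝ) := by
    have h1 : D =Θ[𝓝[>] 0] fun t => (t * u i.1 i.2) ^ 2 :=
      have h := isTheta_add_rpow_sub_rpow ha (r := q.toReal / 2) (by linarith)
      ⟨h.1.comp_tendsto hlim, h.2.comp_tendsto hlim⟩
    refine h1.trans ?_
    simp only [mul_pow, Real.rpow_two]
    have hu' : u i.1 i.2 ^ 2 ≠ 0 := pow_ne_zero 2 hu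
    simp only [mul_comm _ (u i.1 i.2 ^ 2)]
    exact (isTheta_const_mul_left hu').2 (isTheta_refl _ _)
  have hD0 : Tendsto D (𝓝[>] 0) (𝓝 0) := by
    rw [hDθ.tendsto_zero_iff]
    have := (Real.continuousAt_rpow_const 0 2 (Or.inr zero_le_two)).tendsto
    rw [Real.zero_rpow two_ne_zero] at this
    exact this.mono_left nhdsWithin_le_nhds
  have hDpos : ∀ t, 0 ≤ D t := fun t =>
    sub_nonneg.2 (Real.rpow_le_rpow ha.le (by nlinarith [sq_nonneg (t * u i.1 i.2)]) (by linarith))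
  have hO1 : (fun t : ℝ => t ^ (2 : ℝ)) =O[𝓝[>] 0] fun t => (A + D t) ^ r - A ^ r :=
    hDθ.2.trans ((isTheta_add_rpow_sub_rpow hA hr0).2.comp_tendsto hD0)
  have hO2 : (fun t : ℝ => (A + D t) ^ r - A ^ r) =O[𝓝[>] 0] fun t : ℝ =>
      (‖x j.1‖ ^ q.toReal + |t * 1| ^ q.toReal) ^ r - (‖x j.1‖ ^ q.toReal) ^ r := by
    refine IsBigO.of_norm_le fun t => ?_
    have h0 : 0 ≤ (A + D t) ^ r - A ^ r :=
      sub_nonneg.2 (Real.rpow_le_rpow hA.le (by linarith [hDpos t]) hr0.le)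
    rw [Real.norm_of_nonneg h0]
    exact hle t
  have hO3 := isTheta_add_abs_rpow_sub_rpow (α := ‖x j.1‖ ^ q.toReal) (by positivity) hq0 hr0
    (one_ne_zero (α := ℝ))
  refine not_isBigO_rpow_rpow ?_ ((hO1.trans hO2).trans hO3.1)
  have e : q.toReal * r = p.toReal := mul_div_cancel₀ _ hq0.ne'
  split_ifs <;> linarith

/-- For `p, q < 2`, a contractive operator fixing `x` maps vectors supported in the support of `x`
to vectors supported there. Indeed, in the direction of a unit vector in the band of `x` the
symmetrized `p`-th power of the norm grows from `x` at the rate `O(t ^ 2)`, while in directions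
leaving this band it grows at least like `t ^ max p q`. -/
theorem coord_apply_unitVec_of_lt_two (hp1 : 1 ≤ p.toReal) (hq0 : 0 < q.toReal)
    (hp : p.toReal < 2) (hq : q.toReal < 2)
    {P : LpLq p q →L[ℝ] LpLq p q} (hP : ‖P‖ ≤ 1) {x : LpLq p q} (hx : P x = x) {i j : ℕ × ℕ}
    (hi : coord i x = 0) (hj : coord j x ≠ 0) : coord i (P (unitVec j)) = 0 := by
  by_contra hu
  have hp0 : 0 < p.toReal := by linarith
  have hr0 : 0 < p.toReal / q.toReal := div_pos hp0 hq0
  set u := P (unitVec j) with hudef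
  set r := p.toReal / q.toReal with hr
  have hcontr : ∀ t : ℝ, ‖x + t • u‖ ≤ ‖x + t • unitVec j‖ := fun t => by
    rw [hudef, ← map_smul]
    exact norm_add_apply_le hP hx _
  have hmid : ∀ t : ℝ, ‖x + (t * coord i u) • unitVec i‖ ≤ (‖x + t • u‖ + ‖x - t • u‖) / 2 := by
    intro t
    -- Flipping the sign of the coordinate at `i` is an isometry.
    have hflip : ‖x - t • u‖ = ‖x - t • u + (2 * (t * coord i u)) • unitVec i‖ := by
      refine norm_eq_of_abs_coord_eq fun k => ?_
      simp only [map_add, map_sub, map_smul, coord_unitVec, smul_eq_mul]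
      split_ifs with hk
      · subst hk
        rw [hi, ← abs_neg]
        congr 1
        ring
      · simp
    have hsum : (2 : ℝ) • (x + (t * coord i u) • unitVec i) =
        (x + t • u) + (x - t • u + (2 * (t * coord i u)) • unitVec i) := by
      module
    have h := norm_add_le (x + t • u) (x - t • u + (2 * (t * coord i u)) • unitVec i)
    rw [← hsum, ← hflip, norm_smul, Real.norm_two] at h
    linarith
  have hle : ∀ t : ℝ, (‖x i.1‖ ^ q.toReal + |t * coord i u| ^ q.toReal) ^ r -
      (‖x i.1‖ ^ q.toReal) ^ r ≤ (‖x + t • unitVec j‖ ^ p.toReal +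
        ‖x - t • unitVec j‖ ^ p.toReal - 2 * ‖x‖ ^ p.toReal) / 2 := by
    intro t
    have h1 := hcontr t
    have h2 := hcontr (-t)
    rw [neg_smul, neg_smul, ← sub_eq_add_neg, ← sub_eq_add_neg] at h2
    have h3 := norm_add_smul_unitVec_rpow_of_coord_eq_zero hp0 hq0 hi (t * coord i u)
    have h4 : ‖x + (t * coord i u) • unitVec i‖ ^ p.toReal ≤
        ((‖x + t • unitVec j‖ + ‖x - t • unitVec j‖) / 2) ^ p.toReal :=
      Real.rpow_le_rpow (norm_nonneg _) (by linarith [hmid t]) hp0.le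
    have h5 := Real.half_add_rpow_le (norm_nonneg (x + t • unitVec j))
      (norm_nonneg (x - t • unitVec j)) hp1
    linarith
  have hO1 := isTheta_add_abs_rpow_sub_rpow (α := ‖x i.1‖ ^ q.toReal) (by positivity) hq0 hr0 hu
  have hO2 : (fun t : ℝ => (‖x i.1‖ ^ q.toReal + |t * coord i u| ^ q.toReal) ^ r -
      (‖x i.1‖ ^ q.toReal) ^ r) =O[𝓝[>] 0] fun t : ℝ => ‖x + t • unitVec j‖ ^ p.toReal +
        ‖x - t • unitVec j‖ ^ p.toReal - 2 * ‖x‖ ^ p.toReal := by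
    refine IsBigO.of_norm_le fun t => ?_
    have h0 : 0 ≤ (‖x i.1‖ ^ q.toReal + |t * coord i u| ^ q.toReal) ^ r -
        (‖x i.1‖ ^ q.toReal) ^ r :=
      sub_nonneg.2 (Real.rpow_le_rpow (by positivity) (le_add_of_nonneg_right (by positivity))
        hr0.le)
    have h1 := hle t
    rw [Real.norm_of_nonneg h0]
    linarith
  have hO3 := (isBigO_second_difference_norm_rpow hp0 hq0 hj).mono
    (nhdsWithin_le_nhds (s := Set.Ioi (0 : ℝ)))
  simp only [← Real.rpow_two] at hO3
  refine not_isBigO_rpow_rpow ?_ ((hO1.2.trans hO2).trans hO3)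
  have e : q.toReal * r = p.toReal := mul_div_cancel₀ _ hq0.ne'
  split_ifs <;> linarith

/-- If a contraction `P` leaves the band of the complement of `A` invariant, then its fixed points
are stable under the band projection onto `A`: the vector `P (band A y)` agrees with `band A y` on
`A`, and it has no further coordinates since the norm is strictly monotone. -/
theorem apply_band_of_disjoint (hp : p ≠ ⊤) (hq : q ≠ ⊤) {P : LpLq p q →L[ℝ] LpLq p q}
    (hP : ‖P‖ ≤ 1) {A : Set (ℕ × ℕ)} (h : ∀ i ∈ A, ∀ j ∉ A, coord i (P (unitVec j)) = 0)
    {y : LpLq p q} (hy : P y = y) : P (band A y) = band A y := by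
  have hp0 : 0 < p.toReal := ENNReal.toReal_pos (zero_lt_one.trans_le Fact.out).ne' hp
  have hq0 : 0 < q.toReal := ENNReal.toReal_pos (zero_lt_one.trans_le Fact.out).ne' hq
  have hcompl : ((band A).comp P).comp (band Aᶜ) = 0 := by
    refine continuousLinearMap_ext hp hq fun j => ext_coord fun i => ?_
    simp only [ContinuousLinearMap.comp_apply, zero_apply, map_zero]
    by_cases hj : j ∈ A
    · rw [band_unitVec_of_notMem (by simpa using hj), map_zero, map_zero, map_zero]
    · rw [band_unitVec_of_mem (by simpa using hj)]
      by_cases hi : i ∈ A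
      · rw [coord_band_of_mem hi, h i hi j hj]
      · rw [coord_band_of_notMem hi]
  have hband : band A (P (band A y)) = band A y := by
    have h1 : band A (P (band Aᶜ y)) = 0 := DFunLike.congr_fun hcompl y
    rw [band_compl, map_sub, map_sub, hy, sub_eq_zero] at h1
    exact h1.symm
  rw [← band_eq_self_of_norm_le hp0 hq0 (A := A) (x := P (band A y)), hband]
  rw [hband]
  simpa using P.le_of_opNorm_le hP (band A y)

end LpLq

theorem corollary4p3 (p q : ℝ≥0∞) [Fact (1 ≤ p)] [Fact (1 ≤ q)]
    (hpq : (p ∈ Set.Ioo 2 ⊤ ∧ q ∈ Set.Ioo 2 ⊤) ∨ (p ∈ Set.Ioo 1 2 ∧ q ∈ Set.Ioo 1 2))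
    (P : LpLq p q →L[ℝ] LpLq p q) (hP : IsContractiveProjection P) :
    LpLq.HasBlockBasis (LinearMap.range P.toLinearMap) := by
  have hp : p ≠ ⊤ := by
    rcases hpq with h | h
    · exact h.1.2.ne
    · exact (h.1.2.trans (by simp)).ne
  have hq : q ≠ ⊤ := by
    rcases hpq with h | h
    · exact h.2.2.ne
    · exact (h.2.2.trans (by simp)).ne
  have hmem : ∀ x, x ∈ LinearMap.range P.toLinearMap ↔ P x = x := fun x =>
    ⟨fun ⟨y, hy⟩ => by rw [← hy]; exact hP.idempotent y, fun h => ⟨x, h⟩⟩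
  refine LpLq.HasBlockBasis.of_band_supp_mem hp hq _ ?_ fun x hx y hy => ?_
  · have : (LinearMap.range P.toLinearMap : Set (LpLq p q)) = {x | P x = x} :=
      Set.ext fun x => hmem x
    rw [this]
    exact isClosed_eq P.continuous continuous_id
  · rw [hmem] at hx hy ⊢
    rcases hpq with ⟨⟨hp2, -⟩, hq2, -⟩ | ⟨⟨hp1, hp2⟩, hq1, hq2⟩
    · have hp2' : 2 < p.toReal := by simpa using (ENNReal.toReal_lt_toReal (by simp) hp).2 hp2
      have hq2' : 2 < q.toReal := by simpa using (ENNReal.toReal_lt_toReal (by simp) hq).2 hq2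
      refine LpLq.apply_band_of_disjoint hp hq hP.norm_le (fun i hi j hj => ?_) hy
      exact LpLq.coord_apply_unitVec_of_two_lt hp2' hq2' hP.norm_le hx hi (not_not.1 hj)
    · have hp1' : 1 < p.toReal := by simpa using (ENNReal.toReal_lt_toReal (by simp) hp).2 hp1
      have hq1' : 1 < q.toReal := by simpa using (ENNReal.toReal_lt_toReal (by simp) hq).2 hq1
      have hp2' : p.toReal < 2 := by simpa using (ENNReal.toReal_lt_toReal hp (by simp)).2 hp2
      have hq2' : q.toReal < 2 := by simpa using (ENNReal.toReal_lt_toReal hq (by simp)).2 hq2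
      -- Here the band of `x` is invariant, and the component of `y` disjoint from `x` is fixed.
      have h := LpLq.apply_band_of_disjoint hp hq hP.norm_le (A := (LpLq.supp x)ᶜ)
        (fun i hi j hj => LpLq.coord_apply_unitVec_of_lt_two hp1'.le (by linarith) hp2' hq2'
          hP.norm_le hx (not_not.1 hi) (not_not.1 hj)) hy
      rwa [LpLq.band_compl, map_sub, hy, sub_right_inj] at h
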